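/- **Setting.** A non-trivial elementary system $A$ is a labelled Hilbert space $\mathcal H_A=\mathbb C^{d_A}$ with $2\le d_A<\infty$; there is an unlimited supply of differently labelled systems of every dimension. For a finite set $\mathsf A$ of such systems let $\mathcal H_{\mathsf A}=\bigotimes_{A\in\mathsf A}\mathcal H_A$ (tensor factors are identified by their labels, their order is immaterial; $\mathcal H_\emptyset=\mathbb C$). An elementary type is such a finite set $\mathsf A$, i.e. the composite system of its elements; the empty set is the trivial type $I$. Types are the elementary types and, recursively, $(x\to y)$ for types $x,y$. $\mathsf{Ele}_x$ is the set of non-trivial elementary systems occurring in $x$; it is always assumed that none of them occurs twice in $x$. For $A\in\mathsf{Ele}_x$ let $K_x(A)\in\{0,1\}$ be the parity of the number of symbols "$\to$" and "$($" to the right of $A$ in the expression of $x$; $\mathsf{in}_x=\{A\in\mathsf{Ele}_x: K_x(A)=1\}$ and $\mathsf{out}_x=\mathsf{Ele}_x\setminus\mathsf{in}_x$. For an elementary type $E$ put $\mathsf A\|E=\mathsf A\cup E$ and $(x\to y)\|E=(x\to y\|E)$, with $E$ disjoint from the systems already present. For operators $R$ on $\mathcal H_{\mathsf A}$ and $S$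 on $\mathcal H_{\mathsf B}$, with $\mathsf H=\mathsf A\cap\mathsf B$, the link product is the operator on $\mathcal H_{(\mathsf A\cup\mathsf B)\setminus\mathsf H}$ $$R*S=\operatorname{Tr}_{\mathsf H}\big[(R\otimes I_{\mathsf B\setminus\mathsf H})(S^{T_{\mathsf H}}\otimes I_{\mathsf A\setminus\mathsf H})\big].$$ **Maps.** A map $M$ of type $x$ is an operator on $\mathcal H_{\mathsf{Ele}_x}$; for $x=(x_1\to x_2)$ it is the Choi operator of a linear map $\mathcal M$ from operators on $\mathcal H_{\mathsf{Ele}_{x_1}}$ to operators on $\mathcal H_{\mathsf{Ele}_{x_2}}$, so that $(\mathcal M\otimes\mathcal I_E)(\rho)=M*\rho$. The set $\mathsf T(x)$ of admissible maps and the set $\mathsf T_1(x)$ of deterministic maps of type $x$ are defined recursively. * For an elementary type $\mathsf A$: $M\in\mathsf T_1(\mathsf A)$ iff $M\ge0$ and $\operatorname{Tr}M=1$; $M\in\mathsf T(\mathsf A)$ iff $0\le M\le N$ for some $N\in\mathsf T_1(\mathsf A)$. * Call $M$ of type $x\to y$ *completely admissibility-preserving* if, for every elementary type $E$ disjoint from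 $\mathsf{Ele}_{x\to y}$, $\mathcal M\otimes\mathcal I_E$ maps $\mathsf T(x\|E)$ into $\mathsf T(y\|E)$. Then $M\in\mathsf T(x\to y)$ iff $M$ is completely admissibility-preserving and there are finitely many (possibly no) completely admissibility-preserving $N_1,\dots,N_n$ of type $x\to y$ such that $(\mathcal M+\sum_i\mathcal N_i)\otimes\mathcal I_E$ maps $\mathsf T_1(x\|E)$ into $\mathsf T_1(y\|E)$ for every such $E$. Finally, $M\in\mathsf T_1(x\to y)$ iff $M\in\mathsf T(x\to y)$ and $\mathcal M\otimes\mathcal I_E$ maps $\mathsf T_1(x\|E)$ into $\mathsf T_1(y\|E)$ for every such $E$. **Admissible composition.** Let $x,y$ be types. The composition $x*y$ is *admissible* if for all $R\in\mathsf T_1(x)$ and $S\in\mathsf T_1(y)$ there exists a type $z$ (which may depend on $R$ and $S$) with $R*S\in\mathsf T_1(z)$. **Proposition.** Let $x$ and $y$ be types (in neither of which a non-trivial elementary system occurs twice) and let $\mathsf H=\mathsf{Ele}_x\cap\mathsf{Ele}_y$. Put $\widetilde{\mathsf{in}}=(\mathsf{in}_x\cup\mathsf{in}_y)\setminus\mathsf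 H$ and $\widetilde{\mathsf{out}}=(\mathsf{out}_x\cup\mathsf{out}_y)\setminus\mathsf H$. Then the composition $x*y$ is admissible if and only if 1. $\mathsf H\subseteq(\mathsf{in}_x\cap\mathsf{out}_y)\cup(\mathsf{out}_x\cap\mathsf{in}_y)$, and 2. for all $R\in\mathsf T_1(x)$ and all $S\in\mathsf T_1(y)$, $R*S\in\mathsf T_1(\widetilde{\mathsf{in}}\to\widetilde{\mathsf{out}})$. -/

import Mathlib

namespace HOQ

open scoped ComplexOrder

/-! ### Systems and operators -/

/-- A non-trivial elementary system: a Hilbert space dimension which is at least two, together with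
a label. There are infinitely many differently labelled systems of every dimension. -/
structure Sys where
  /-- the dimension of the Hilbert space -/
  dim : ℕ
  two_le_dim : 2 ≤ dim
  /-- the label, which tells copies of the same system apart -/
  name : ℕ
  deriving DecidableEq

/-- The labels of the computational basis of `H_A = ⨂_{i ∈ A} ℂ^{dim i}`. -/
abbrev Idx (A : Finset Sys) : Type := (i : {i : Sys // i ∈ A}) → Fin i.1.dim

/-- The operators on `H_A`, as matrices in the computational basis. Since tensor factors are
labelled, the order of the factors is immaterial. For `A = ∅` these are the scalars. -/
abbrev Op (A : Finset Sys) : Type := Matrix (Idx A) (Idx A) ℂ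

/-- The part of a basis label of `H_C` that belongs to the systems in `A ⊆ C`. -/
def Idx.restrict {A C : Finset Sys} (h : A ⊆ C) (k : Idx C) : Idx A := fun i => k ⟨i.1, h i.2⟩

/-- The basis label that is `h` on the systems of `H` and `k` on the other systems of `A`. -/
def Idx.glue {A H : Finset Sys} (k : Idx (A \ H)) (h : Idx H) : Idx A := fun i =>
  if hi : i.1 ∈ H then h ⟨i.1, hi⟩ else k ⟨i.1, Finset.mem_sdiff.2 ⟨i.2, hi⟩⟩

/-- The basis label that is `h` on the systems in `H` and `k` on the other ones. -/
def Idx.mix {A : Finset Sys} (H : Finset Sys) (h k : Idx A) : Idx A := fun i =>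
  if i.1 ∈ H then h i else k i

/-- `M ⊗ I_{C \ A}`, for `M` an operator on `H_A` and `A ⊆ C`. -/
def pad {A C : Finset Sys} (h : A ⊆ C) (M : Op A) : Op C := Matrix.of fun k l =>
  if ∀ i : {i : Sys // i ∈ C}, i.1 ∉ A → k i = l i then M (k.restrict h) (l.restrict h) else 0

/-- The partial transpose of `M` on the systems in `H`. -/
def partialTranspose {A : Finset Sys} (H : Finset Sys) (M : Op A) : Op A := Matrix.of fun k l =>
  M (Idx.mix H l k) (Idx.mix H k l)

/-- The partial trace of `M` over the systems in `H ⊆ A`. -/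
def partialTrace {A : Finset Sys} (H : Finset Sys) (_hH : H ⊆ A) (M : Op A) : Op (A \ H) :=
  Matrix.of fun k l => ∑ h : Idx H, M (Idx.glue k h) (Idx.glue l h)

/-- The link product
`R * S = Tr_H [(R ⊗ I_{B \ H}) (S^{T_H} ⊗ I_{A \ H})]`, where `H = A ∩ B`. -/
def link {A B : Finset Sys} (R : Op A) (S : Op B) : Op ((A ∪ B) \ (A ∩ B)) :=
  partialTrace (A ∩ B) (Finset.inter_subset_left.trans Finset.subset_union_left)
    (pad Finset.subset_union_left R *
      pad Finset.subset_union_right (partialTranspose (A ∩ B) S))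

/-! ### Types -/

/-- Types of higher order maps. An elementary type is a quantum system; it is given as the finite
set of the non-trivial elementary systems of which it is composed: `elem {A}` is the system `A`,
`elem {A, B}` is the composite system `AB`, and `elem ∅` is the trivial system `I`.
`arrow x y` is the type `(x → y)` of the maps that transform maps of type `x` into maps of
type `y`. -/
inductive HOType : Type
  | elem (A : Finset Sys) : HOType
  | arrow (x y : HOType) : HOType

namespace HOType

/-- The set of the non-trivial elementary systems which occur in the expression of a type. -/
def ele : HOType → Finset Sys
  | elem A => A
  | arrow x y => x.ele ∪ y.ele

/-- No non-trivial elementary system occurs twice in the expression of the type. -/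
def NonRep : HOType → Prop
  | elem _ => True
  | arrow x y => x.NonRep ∧ y.NonRep ∧ Disjoint x.ele y.ele

/-- The number of arrows in the expression of a type. -/
def arrows : HOType → ℕ
  | elem _ => 0
  | arrow x y => x.arrows + 1 + y.arrows

/-- The number of open brackets in the expression of a type; a compound type is
written `(x → y)`. -/
def opens : HOType → ℕ
  | elem _ => 0
  | arrow x y => 1 + x.opens + y.opens

/-- The number of arrows and open brackets to the right of `A` in the expression of a type. -/
def rightCount : HOType → Sys → ℕ
  | elem _, _ => 0
  | arrow x y, A => if A ∈ x.ele then x.rightCount A + 1 + y.arrows + y.opens else y.rightCount A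

/-- The input systems of a type: those with an odd number of arrows and open brackets to
their right. -/
def inp (x : HOType) : Finset Sys := x.ele.filter fun A => x.rightCount A % 2 = 1

/-- The output systems of a type: the elementary systems that are not inputs. -/
def out (x : HOType) : Finset Sys := x.ele \ x.inp

/-- The extension `x || E` of a type by an elementary type:
`A || E = AE` and `(x → y) || E = (x → y || E)`. -/
def ext : HOType → Finset Sys → HOType
  | elem A, E => elem (A ∪ E)
  | arrow x y, E => arrow x (y.ext E)

theorem arrows_ext (x : HOType) (E : Finset Sys) : (x.ext E).arrows = x.arrows := by
  induction x with
  | elem A => rfl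
  | arrow x y _ ih => simp only [ext, arrows, ih]

end HOType

open HOType

/-! ### Admissible and deterministic maps

A map of type `x` is represented by its Choi operator on `H_x`, `x.ele` being the set of the tensor
factors. If `M` is the Choi operator of a linear map `𝓜` from operators on `H_x` to operators on
`H_y` and `ρ` is an operator on `H_x ⊗ H_E`, then
`(𝓜 ⊗ 𝓘_E)(ρ) = Tr_x [(M ⊗ I_E) (ρ^{T_x} ⊗ I_y)]`, and this is `link M ρ`. -/

mutual

/-- `Adm x A M`: the operator `M` on `H_A` is an admissible map of type `x`, so in particular `A`
is the set of the elementary systems of `x`. -/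
def Adm : HOType → (A : Finset Sys) → Op A → Prop
  | elem B, A, M => A = B ∧ M.PosSemidef ∧
      ∃ N : Op A, N.PosSemidef ∧ N.trace = 1 ∧ (N - M).PosSemidef
  | arrow x y, A, M => A = (arrow x y).ele ∧
      (∀ E : Finset Sys, Disjoint E A → ∀ (B : Finset Sys) (ρ : Op B),
        Adm (x.ext E) B ρ → Adm (y.ext E) _ (link M ρ)) ∧
      ∃ (n : ℕ) (N : Fin n → Op A),
        (∀ i, ∀ E : Finset Sys, Disjoint E A → ∀ (B : Finset Sys) (ρ : Op B),
          Adm (x.ext E) B ρ → Adm (y.ext E) _ (link (N i) ρ)) ∧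
        (∀ E : Finset Sys, Disjoint E A → ∀ (B : Finset Sys) (ρ : Op B),
          Det (x.ext E) B ρ → Det (y.ext E) _ (link (M + ∑ i, N i) ρ))
  termination_by x => (x.arrows, 0)
  decreasing_by
    all_goals
      simp only [arrows_ext, arrows]
      exact Prod.Lex.left _ _ (by omega)

/-- `Det x A M`: the operator `M` on `H_A` is a deterministic map of type `x`, so in particular `A`
is the set of the elementary systems of `x`. -/
def Det : HOType → (A : Finset Sys) → Op A → Prop
  | elem B, A, M => A = B ∧ M.PosSemidef ∧ M.trace = 1
  | arrow x y, A, M => Adm (arrow x y) A M ∧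
      ∀ E : Finset Sys, Disjoint E A → ∀ (B : Finset Sys) (ρ : Op B),
        Det (x.ext E) B ρ → Det (y.ext E) _ (link M ρ)
  termination_by x => (x.arrows, 1)
  decreasing_by
    all_goals first
      | exact Prod.Lex.right _ (by omega)
      | (simp only [arrows_ext, arrows]
         exact Prod.Lex.left _ _ (by omega))

end

/-- The composition `x * y` is admissible: for all deterministic `R` of type `x` and `S` of
type `y` there is a type `z` such that `R * S` is a deterministic map of type `z`. -/
def AdmissibleComp (x y : HOType) : Prop :=
  ∀ (R : Op x.ele) (S : Op y.ele), Det x x.ele R → Det y y.ele S →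
    ∃ z : HOType, z.NonRep ∧ Det z _ (link R S)

/-- `(in_x ∪ in_y) \ H`, where `H` is the set of the shared systems. -/
def compIn (x y : HOType) : Finset Sys := (x.inp ∪ y.inp) \ (x.ele ∩ y.ele)

/-- `(out_x ∪ out_y) \ H`, where `H` is the set of the shared systems. -/
def compOut (x y : HOType) : Finset Sys := (x.out ∪ y.out) \ (x.ele ∩ y.ele)

end HOQ

open Function

namespace HOQ

open scoped ComplexOrder

/-! ### Kernels on the global basis labels -/

/-- A basis label for every elementary system. -/
abbrev Glob : Type := (s : Sys) → Fin s.dim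

/-- A kernel on the global basis labels. Operators on different sets of systems are compared
through their kernels, see `lift`. -/
abbrev Ker : Type := Glob → Glob → ℂ

instance : Inhabited Glob := ⟨fun s => ⟨0, by have := s.two_le_dim; omega⟩⟩

/-- The label `k` with its entries in `H` replaced by those of `h`. -/
abbrev upd (k : Glob) (H : Finset Sys) (h : Idx H) : Glob :=
  Function.updateFinset (π := fun s : Sys => Fin s.dim) k H h

/-- The part of a global label that belongs to `A`. -/
def res (A : Finset Sys) (k : Glob) : Idx A := fun i => k i.1

@[simp] theorem upd_res (k : Glob) (A : Finset Sys) : upd k A (res A k) = k := by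
  funext i; simp [updateFinset, res]

@[simp] theorem res_upd (k : Glob) (A : Finset Sys) (h : Idx A) : res A (upd k A h) = h := by
  funext i; simp [updateFinset, res]

/-- The kernel `F` only depends on the entries of its arguments in `A`. -/
def Supp (A : Finset Sys) (F : Ker) : Prop :=
  ∀ ⦃k k' l l' : Glob⦄, (∀ i ∈ A, k i = k' i) → (∀ i ∈ A, l i = l' i) → F k l = F k' l'

/-- Positive semidefinite kernels. -/
def PSD (F : Ker) : Prop := (Matrix.of F).PosSemidef

/-- Contraction of both arguments over the labels in `H`. -/
def contract (H : Finset Sys) (F : Ker) : Ker := fun k l =>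
  ∑ h : Idx H, ∑ h' : Idx H, F (upd k H h) (upd l H h')

/-- The kernel of the identity operator on `A`. -/
def delta (A : Finset Sys) : Ker := fun k l => if ∀ i ∈ A, k i = l i then 1 else 0

/-- The kernel of an operator on `A`. -/
def lift {A : Finset Sys} (M : Op A) : Ker := fun k l => M (res A k) (res A l)

/-! #### Support -/

theorem Supp.mono {A B : Finset Sys} {F : Ker} (hF : Supp A F) (h : A ⊆ B) : Supp B F :=
  fun _ _ _ _ hk hl => hF (fun i hi => hk i (h hi)) (fun i hi => hl i (h hi))

theorem Supp.mul {A : Finset Sys} {F G : Ker} (hF : Supp A F) (hG : Supp A G) :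
    Supp A (F * G) := fun _ _ _ _ hk hl => by
  simp only [Pi.mul_apply]
  rw [hF hk hl, hG hk hl]

theorem Supp.add {A : Finset Sys} {F G : Ker} (hF : Supp A F) (hG : Supp A G) :
    Supp A (F + G) := fun _ _ _ _ hk hl => by
  simp only [Pi.add_apply]
  rw [hF hk hl, hG hk hl]

theorem Supp.smul {A : Finset Sys} {F : Ker} (c : ℂ) (hF : Supp A F) : Supp A (c • F) :=
  fun _ _ _ _ hk hl => by
    simp only [Pi.smul_apply]
    rw [hF hk hl]

theorem Supp.delta (A : Finset Sys) : Supp A (delta A) := fun k k' l l' hk hl => by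
  have : (∀ i ∈ A, k i = l i) ↔ (∀ i ∈ A, k' i = l' i) :=
    forall₂_congr fun i hi => by rw [hk i hi, hl i hi]
  simp only [HOQ.delta, this]

theorem Supp.contract {A : Finset Sys} {F : Ker} (hF : Supp A F) (H : Finset Sys) :
    Supp (A \ H) (contract H F) := fun k k' l l' hk hl => by
  refine Finset.sum_congr rfl fun h _ => Finset.sum_congr rfl fun h' _ => hF ?_ ?_
  · intro i hi
    by_cases hH : i ∈ H
    · simp [updateFinset, hH]
    · simp [updateFinset, hH, hk i (Finset.mem_sdiff.2 ⟨hi, hH⟩)]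
  · intro i hi
    by_cases hH : i ∈ H
    · simp [updateFinset, hH]
    · simp [updateFinset, hH, hl i (Finset.mem_sdiff.2 ⟨hi, hH⟩)]

theorem Supp.upd_left {A H : Finset Sys} {F : Ker} (hF : Supp A F) (hd : Disjoint A H)
    (k l : Glob) (h h' : Idx H) : F (upd k H h) (upd l H h') = F k l := by
  refine hF ?_ ?_ <;>
  · intro i hi
    simp [updateFinset, Finset.disjoint_left.1 hd hi]

/-! #### Contraction -/

theorem contract_mul_left {A H : Finset Sys} {F : Ker} (hF : Supp A F) (hd : Disjoint A H)
    (G : Ker) : contract H (F * G) = F * contract H G := by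
  funext k l
  simp only [contract, Pi.mul_apply, hF.upd_left hd, Finset.mul_sum]

theorem contract_mul_right {A H : Finset Sys} {F : Ker} (hF : Supp A F) (hd : Disjoint A H)
    (G : Ker) : contract H (G * F) = contract H G * F := by
  rw [mul_comm, contract_mul_left hF hd, mul_comm]

theorem contract_add (H : Finset Sys) (F G : Ker) :
    contract H (F + G) = contract H F + contract H G := by
  funext k l
  simp only [contract, Pi.add_apply, Finset.sum_add_distrib]

theorem contract_sub (H : Finset Sys) (F G : Ker) :
    contract H (F - G) = contract H F - contract H G := by
  funext k l
  simp only [contract, Pi.sub_apply, Finset.sum_sub_distrib]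

theorem contract_smul (H : Finset Sys) (c : ℂ) (F : Ker) :
    contract H (c • F) = c • contract H F := by
  funext k l
  simp only [contract, Pi.smul_apply, Finset.smul_sum]

@[simp] theorem contract_empty (F : Ker) : contract ∅ F = F := by
  funext k l
  simp [contract]

theorem sum_upd_union {H K : Finset Sys} (hd : Disjoint H K) (f : Glob → ℂ) (k : Glob) :
    ∑ h : Idx (H ∪ K), f (upd k (H ∪ K) h) =
      ∑ a : Idx H, ∑ b : Idx K, f (upd (upd k H a) K b) := by
  rw [← Fintype.sum_prod_type']
  symm
  refine Fintype.sum_equiv (Equiv.piFinsetUnion (fun s : Sys => Fin s.dim) hd) _ _ fun p => ?_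
  rw [upd, upd, updateFinset_updateFinset hd]

theorem contract_union {H K : Finset Sys} (hd : Disjoint H K) (F : Ker) :
    contract (H ∪ K) F = contract H (contract K F) := by
  funext k l
  refine (sum_upd_union hd (fun k' => ∑ h' : Idx (H ∪ K), F k' (upd l (H ∪ K) h')) k).trans ?_
  refine Finset.sum_congr rfl fun a _ => Eq.trans ?_ Finset.sum_comm
  exact Finset.sum_congr rfl fun b _ => sum_upd_union hd (fun l' => F _ l') l

theorem contract_comm {H K : Finset Sys} (hd : Disjoint H K) (F : Ker) :
    contract H (contract K F) = contract K (contract H F) := by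
  rw [← contract_union hd, Finset.union_comm, contract_union hd.symm]

/-! #### Identity kernels -/

@[simp] theorem delta_empty : delta ∅ = 1 := by
  funext k l
  simp [delta]

theorem delta_union (A B : Finset Sys) : delta (A ∪ B) = delta A * delta B := by
  funext k l
  have : (∀ i ∈ A ∪ B, k i = l i) ↔ (∀ i ∈ A, k i = l i) ∧ (∀ i ∈ B, k i = l i) := by
    simp only [Finset.mem_union, or_imp, forall_and]
  simp only [delta, Pi.mul_apply, this]
  split_ifs <;> simp_all

theorem delta_upd (A : Finset Sys) (k l : Glob) (h h' : Idx A) :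
    delta A (upd k A h) (upd l A h') = if h = h' then 1 else 0 := by
  have : (∀ i ∈ A, upd k A h i = upd l A h' i) ↔ h = h' := by
    constructor
    · intro H
      funext i
      simpa [updateFinset] using H i.1 i.2
    · rintro rfl i hi
      simp [updateFinset, hi]
  simp only [delta, this]

/-- Contraction against the identity is the partial trace. -/
theorem contract_mul_delta (A : Finset Sys) (F : Ker) (k l : Glob) :
    contract A (F * delta A) k l = ∑ h : Idx A, F (upd k A h) (upd l A h) := by
  simp [contract, delta_upd]

/-- The partial trace over a union is the iterated partial trace. -/
theorem trace_union {H K : Finset Sys} (hd : Disjoint H K) (F : Ker) :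
    contract (H ∪ K) (F * delta (H ∪ K)) = contract H (contract K (F * delta K) * delta H) := by
  rw [contract_union hd, delta_union, mul_comm (delta H), ← mul_assoc,
    contract_mul_right (Supp.delta H) hd]

/-! #### Positivity -/

theorem PSD.mul {F G : Ker} (hF : PSD F) (hG : PSD G) : PSD (F * G) :=
  Matrix.PosSemidef.hadamard hF hG

theorem PSD.add {F G : Ker} (hF : PSD F) (hG : PSD G) : PSD (F + G) :=
  Matrix.PosSemidef.add hF hG

theorem PSD.smul {F : Ker} (hF : PSD F) {c : ℂ} (hc : 0 ≤ c) : PSD (c • F) :=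
  Matrix.PosSemidef.smul hF hc

theorem PSD.comp {F : Ker} (hF : PSD F) (e : Glob → Glob) : PSD fun k l => F (e k) (e l) :=
  Matrix.PosSemidef.submatrix hF e

theorem PSD.zero : PSD 0 := Matrix.PosSemidef.zero

theorem posSemidef_sum_prod {n ι : Type*} [Fintype ι] {M : Matrix (n × ι) (n × ι) ℂ}
    (hM : M.PosSemidef) :
    (Matrix.of fun k l => ∑ h, ∑ h', M (k, h) (l, h')).PosSemidef := by
  classical
  refine ⟨?_, fun x => ?_⟩
  · ext k l
    simp only [Matrix.conjTranspose_apply, Matrix.of_apply, star_sum]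
    rw [Finset.sum_comm]
    exact Finset.sum_congr rfl fun h _ => Finset.sum_congr rfl fun h' _ => hM.1.apply _ _
  · obtain ⟨X, hX⟩ : ∃ X : n × ι →₀ ℂ, ∀ f : n × ι → ℂ → ℂ, (∀ a, f a 0 = 0) →
        X.sum f = x.sum fun i xi => ∑ h, f (i, h) xi := by
      refine ⟨Finsupp.onFinset (x.support ×ˢ Finset.univ) (fun p => x p.1)
        (fun p hp => by simpa using hp), fun f hf => ?_⟩
      rw [Finsupp.onFinset_sum _ hf, Finset.sum_product, Finsupp.sum]
    have h := hM.2 X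
    rw [hX _ (by simp)] at h
    convert h using 1
    refine Finsupp.sum_congr fun i _ => ?_
    have h1 : ∀ h : ι, (X.sum fun j xj => star (x i) * M (i, h) j * xj) =
        x.sum fun j xj => ∑ h', star (x i) * M (i, h) (j, h') * xj :=
      fun h => hX _ (by simp)
    rw [Finset.sum_congr rfl fun h _ => h1 h]
    simp only [Finsupp.sum, Matrix.of_apply]
    rw [Finset.sum_comm]
    refine Finset.sum_congr rfl fun j _ => ?_
    simp only [Finset.mul_sum, Finset.sum_mul]

theorem PSD.contract {F : Ker} (hF : PSD F) (H : Finset Sys) : PSD (contract H F) :=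
by
  have h := Matrix.PosSemidef.submatrix hF (fun p : Glob × Idx H => upd p.1 H p.2)
  have h' := posSemidef_sum_prod h
  have e : Matrix.of (HOQ.contract H F) = Matrix.of fun k l => ∑ a : Idx H, ∑ b : Idx H,
      (Matrix.of F).submatrix (fun p : Glob × Idx H => upd p.1 H p.2)
        (fun p : Glob × Idx H => upd p.1 H p.2) (k, a) (l, b) := by
    ext k l
    simp only [HOQ.contract, Matrix.of_apply, Matrix.submatrix_apply]
  rw [PSD, e]
  exact h'

/-- Rank one kernels are positive. -/
theorem PSD.rankOne (v : Glob → ℂ) : PSD fun k l => v k * star (v l) := by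
  refine ⟨?_, fun x => ?_⟩
  · ext k l
    simp [mul_comm]
  · have : (x.sum fun i xi => x.sum fun j xj =>
        star xi * Matrix.of (fun k l => v k * star (v l)) i j * xj) =
        (x.sum fun i xi => star xi * v i) * star (x.sum fun i xi => star xi * v i) := by
      simp only [Finsupp.sum, star_sum, Finset.sum_mul_sum, Matrix.of_apply, star_mul', star_star]
      refine Finset.sum_congr rfl fun i _ => Finset.sum_congr rfl fun j _ => ?_
      ring
    rw [this]
    exact mul_star_self_nonneg _

theorem PSD.delta (A : Finset Sys) : PSD (delta A) := by
  have h : (1 : Matrix (Idx A) (Idx A) ℂ).PosSemidef := Matrix.PosSemidef.one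
  have h' := h.submatrix (res A)
  have : Matrix.of (HOQ.delta A) = (1 : Matrix (Idx A) (Idx A) ℂ).submatrix (res A) (res A) := by
    ext k l
    have : (∀ i ∈ A, k i = l i) ↔ res A k = res A l :=
      ⟨fun H => funext fun i => H i.1 i.2, fun H i hi => congrFun H ⟨i, hi⟩⟩
    simp only [HOQ.delta, Matrix.of_apply, Matrix.submatrix_apply, Matrix.one_apply, this]
  rw [PSD, this]
  exact h'

/-! #### Kernels of operators -/

section

variable {A : Finset Sys}

theorem lift_supp (M : Op A) : Supp A (lift M) := fun k k' l l' hk hl => by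
  have h1 : res A k = res A k' := funext fun i => hk i.1 i.2
  have h2 : res A l = res A l' := funext fun i => hl i.1 i.2
  simp only [lift, h1, h2]

theorem lift_add (M N : Op A) : lift (M + N) = lift M + lift N := rfl

theorem lift_sub (M N : Op A) : lift (M - N) = lift M - lift N := rfl

theorem lift_apply_upd (M : Op A) (k l : Glob) (h h' : Idx A) :
    lift M (upd k A h) (upd l A h') = M h h' := by
  simp only [lift, res_upd]

/-- A kernel that is supported on `A` is the kernel of an operator on `A`. -/
theorem Supp.exists_lift {F : Ker} (hF : Supp A F) : ∃ M : Op A, lift M = F := by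
  refine ⟨Matrix.of fun a b => F (upd default A a) (upd default A b), ?_⟩
  funext k l
  refine hF ?_ ?_ <;>
  · intro i hi
    simp [updateFinset, hi, res]

theorem psd_lift_iff {M : Op A} : PSD (lift M) ↔ M.PosSemidef := by
  constructor
  · intro h
    have := Matrix.PosSemidef.submatrix h (fun a : Idx A => upd default A a)
    convert this using 1
    ext a b
    exact (lift_apply_upd M _ _ a b).symm
  · intro h
    exact h.submatrix (res A)

theorem trace_lift (M : Op A) : contract A (lift M * delta A) = fun _ _ => M.trace := by
  funext k l
  rw [contract_mul_delta]
  simp only [lift_apply_upd, Matrix.trace, Matrix.diag]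

end

/-! ### The kernel of a link product -/

theorem lift_link {A B : Finset Sys} (R : Op A) (S : Op B) :
    lift (link R S) = contract (A ∩ B) (lift R * lift S) := by
  funext k l
  simp only [lift, link, partialTrace, contract, Matrix.of_apply, Matrix.mul_apply, Pi.mul_apply]
  refine Finset.sum_congr rfl fun h _ => ?_
  symm
  refine Fintype.sum_of_injective
    (fun (h' : Idx (A ∩ B)) (i : {i : Sys // i ∈ A ∪ B}) =>
      if i.1 ∈ A then upd l (A ∩ B) h' i.1 else k i.1) ?_ _ _ ?_ ?_
  · intro a b hab
    funext i
    have hi := Finset.mem_inter.1 i.2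
    have := congrFun hab ⟨i.1, Finset.mem_union_left _ hi.1⟩
    simpa [updateFinset, hi.1, hi.2] using this
  · intro m hm
    by_contra hne
    refine hm ⟨fun i => m ⟨i.1, Finset.mem_union_left _ (Finset.mem_inter.1 i.2).1⟩, ?_⟩
    have h1 := left_ne_zero_of_mul hne
    have h2 := right_ne_zero_of_mul hne
    simp only [pad, Matrix.of_apply, ne_eq, ite_eq_right_iff, not_forall] at h1 h2
    obtain ⟨h1, -⟩ := h1
    obtain ⟨h2, -⟩ := h2
    funext i
    by_cases hA : i.1 ∈ A
    · by_cases hB : i.1 ∈ B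
      · simp [updateFinset, hA, hB]
      · have := h2 i hB
        simp [updateFinset, hA, hB, Idx.glue, res] at this ⊢
        exact this.symm
    · have := h1 i hA
      simpa [hA, Idx.glue, res] using this
  · intro h'
    have e1 : ∀ i : {i : Sys // i ∈ A ∪ B}, i.1 ∉ A →
        Idx.glue (res ((A ∪ B) \ (A ∩ B)) k) h i =
          (if i.1 ∈ A then upd l (A ∩ B) h' i.1 else k i.1) := by
      intro i hi
      simp [hi, Idx.glue, res]
    have e2 : ∀ i : {i : Sys // i ∈ A ∪ B}, i.1 ∉ B →
        (if i.1 ∈ A then upd l (A ∩ B) h' i.1 else k i.1) =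
          Idx.glue (res ((A ∪ B) \ (A ∩ B)) l) h i := by
      intro i hi
      have hA : i.1 ∈ A := (Finset.mem_union.1 i.2).resolve_right hi
      simp [hi, hA, Idx.glue, res, updateFinset]
    simp only [pad, Matrix.of_apply]
    rw [if_pos e1, if_pos e2]
    simp only [partialTranspose, Matrix.of_apply]
    congr 1
    · congr 1
      funext i
      by_cases hB : i.1 ∈ B <;> simp [res, Idx.restrict, updateFinset, i.2, hB]
    · congr 1 <;> funext i
      · by_cases hA : i.1 ∈ A <;>
          simp [res, Idx.restrict, Idx.glue, Idx.mix, updateFinset, i.2, hA]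
      · by_cases hA : i.1 ∈ A <;>
          simp [res, Idx.restrict, Idx.glue, Idx.mix, updateFinset, i.2, hA]

/-! ### Partial traces of kernels -/

/-- The partial trace of a kernel over the systems in `A`. -/
def ptr (A : Finset Sys) (F : Ker) : Ker := contract A (F * delta A)

theorem ptr_apply (A : Finset Sys) (F : Ker) (k l : Glob) :
    ptr A F k l = ∑ h : Idx A, F (upd k A h) (upd l A h) := contract_mul_delta A F k l

theorem ptr_mul_left {A B : Finset Sys} {F : Ker} (hF : Supp B F) (hd : Disjoint B A) (G : Ker) :
    ptr A (F * G) = F * ptr A G := by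
  rw [ptr, mul_assoc, contract_mul_left hF hd, ptr]

theorem ptr_mul_right {A B : Finset Sys} {F : Ker} (hF : Supp B F) (hd : Disjoint B A) (G : Ker) :
    ptr A (G * F) = ptr A G * F := by
  rw [mul_comm, ptr_mul_left hF hd, mul_comm]

theorem ptr_union {A B : Finset Sys} (hd : Disjoint A B) (F : Ker) :
    ptr (A ∪ B) F = ptr A (ptr B F) := trace_union hd F

theorem ptr_contract_comm {A B : Finset Sys} (hd : Disjoint A B) (F : Ker) :
    ptr A (contract B F) = contract B (ptr A F) := by
  rw [ptr, ptr, ← contract_mul_right (Supp.delta A) hd, contract_comm hd]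

theorem ptr_add (A : Finset Sys) (F G : Ker) : ptr A (F + G) = ptr A F + ptr A G := by
  rw [ptr, add_mul, contract_add, ptr, ptr]

theorem ptr_smul (A : Finset Sys) (c : ℂ) (F : Ker) : ptr A (c • F) = c • ptr A F := by
  rw [ptr, smul_mul_assoc, contract_smul, ptr]

@[simp] theorem ptr_empty (F : Ker) : ptr ∅ F = F := by
  rw [ptr, contract_empty, delta_empty, mul_one]

theorem Supp.ptr {A : Finset Sys} {F : Ker} (hF : Supp A F) (H : Finset Sys) :
    Supp (A \ H) (ptr H F) :=
  (((hF.mono Finset.subset_union_left).mul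
    ((Supp.delta H).mono Finset.subset_union_right)).contract H).mono
    (by rw [Finset.union_sdiff_right])

theorem PSD.ptr {F : Ker} (hF : PSD F) (H : Finset Sys) : PSD (ptr H F) :=
  (hF.mul (PSD.delta H)).contract H

theorem ptr_delta (A : Finset Sys) : ptr A (delta A) = fun _ _ => (Fintype.card (Idx A) : ℂ) := by
  funext k l
  rw [ptr_apply]
  simp [delta_upd]

/-! ### States separate kernels -/

theorem matrix_eq_zero_of_quadratic {n : Type*} [Fintype n] [DecidableEq n] (N : n → n → ℂ)
    (h : ∀ v : n → ℂ, ∑ a, ∑ b, N a b * (v a * star (v b)) = 0) (a b : n) : N a b = 0 := by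
  have key : ∀ c : ℂ, N a a + N a b * star c + N b a * c + N b b * (c * star c) = 0 := by
    intro c
    have := h (Pi.single a 1 + Pi.single b c)
    simp only [Pi.add_apply, star_add, mul_add, add_mul, Finset.sum_add_distrib] at this
    simp [Pi.single_apply, apply_ite] at this
    simp only [RCLike.star_def]
    linear_combination this
  have h0 := key 0
  have h1 := key 1
  have h2 := key (-1)
  have h3 := key Complex.I
  simp at h0 h1 h2 h3
  rw [h0] at h1 h2 h3
  have hbb : N b b = 0 := by linear_combination (h1 + h2) / 2
  rw [hbb] at h1 h3
  have hI : N b a = N a b := by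
    have : Complex.I * (N b a - N a b) = 0 := by linear_combination h3
    rcases mul_eq_zero.1 this with h | h
    · exact absurd h Complex.I_ne_zero
    · exact sub_eq_zero.1 h
  rw [hI] at h1
  linear_combination h1 / 2

/-- The kernel of a rank one operator on `A`. -/
theorem supp_rankOne {A : Finset Sys} (v : Idx A → ℂ) :
    Supp A fun k l => v (res A k) * star (v (res A l)) := fun k k' l l' hk hl => by
  have h1 : res A k = res A k' := funext fun i => hk i.1 i.2
  have h2 : res A l = res A l' := funext fun i => hl i.1 i.2
  simp only [h1, h2]

theorem eq_zero_of_contract_states {A : Finset Sys} {L : Ker}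
    (h : ∀ σ, Supp A σ → PSD σ → ptr A σ = 1 → contract A (L * σ) = 0) : L = 0 := by
  funext k l
  have := matrix_eq_zero_of_quadratic (fun a b => L (upd k A a) (upd l A b)) ?_ (res A k) (res A l)
  · simpa using this
  · intro v
    by_cases hv : v = 0
    · simp [hv]
    set c : ℝ := ∑ a, ‖v a‖ ^ 2 with hc
    have hc0 : 0 < c := by
      obtain ⟨a, ha⟩ := Function.ne_iff.1 hv
      exact Finset.sum_pos' (fun _ _ => by positivity)
        ⟨a, Finset.mem_univ _, by have := norm_pos_iff.2 ha; positivity⟩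
    have hcC : (c : ℂ) ≠ 0 := by exact_mod_cast hc0.ne'
    have key := h ((c : ℂ)⁻¹ • fun k l => v (res A k) * star (v (res A l)))
      ((supp_rankOne v).smul _)
      ((PSD.rankOne fun k => v (res A k)).smul (by
        rw [← Complex.ofReal_inv]; exact_mod_cast (inv_pos.2 hc0).le)) (by
        rw [ptr_smul]
        funext k l
        simp only [Pi.smul_apply, ptr_apply, res_upd, smul_eq_mul, Pi.one_apply]
        rw [inv_mul_eq_one₀ hcC, hc]
        push_cast
        exact Finset.sum_congr rfl fun a _ => (Complex.mul_conj' (v a)).symm)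
    have key' := congrFun (congrFun key k) l
    rw [mul_smul_comm, contract_smul] at key'
    simp only [Pi.smul_apply, contract, Pi.mul_apply, res_upd, smul_eq_mul, Pi.zero_apply,
      mul_eq_zero, inv_eq_zero, hcC, false_or] at key'
    exact key'

/-! ### Inputs and outputs of types -/

namespace HOType

theorem opens_eq_arrows (x : HOType) : x.opens = x.arrows := by
  induction x with
  | elem A => rfl
  | arrow x y hx hy => simp only [opens, arrows, hx, hy]; omega

theorem inp_subset (x : HOType) : x.inp ⊆ x.ele := Finset.filter_subset _ _

theorem out_subset (x : HOType) : x.out ⊆ x.ele := Finset.sdiff_subset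

theorem disjoint_inp_out (x : HOType) : Disjoint x.inp x.out := Finset.disjoint_sdiff

theorem inp_union_out (x : HOType) : x.inp ∪ x.out = x.ele :=
  Finset.union_sdiff_of_subset x.inp_subset

@[simp] theorem inp_elem (A : Finset Sys) : (elem A).inp = ∅ := by
  simp [inp, rightCount]

@[simp] theorem out_elem (A : Finset Sys) : (elem A).out = A := by
  simp [out, ele]

theorem mem_inp {x : HOType} {a : Sys} : a ∈ x.inp ↔ a ∈ x.ele ∧ x.rightCount a % 2 = 1 :=
  Finset.mem_filter

theorem mem_out {x : HOType} {a : Sys} : a ∈ x.out ↔ a ∈ x.ele ∧ a ∉ x.inp :=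
  Finset.mem_sdiff

theorem inp_arrow {x y : HOType} (h : Disjoint x.ele y.ele) :
    (arrow x y).inp = x.out ∪ y.inp := by
  ext a
  have := opens_eq_arrows y
  have hd := @Finset.disjoint_left _ x.ele y.ele
  simp only [mem_inp, mem_out, Finset.mem_union, ele, rightCount]
  by_cases hx : a ∈ x.ele
  · have hy := hd.1 h hx
    simp only [hx, hy, if_true, true_and, false_and, or_false]
    omega
  · simp [hx]

theorem out_arrow {x y : HOType} (h : Disjoint x.ele y.ele) :
    (arrow x y).out = x.inp ∪ y.out := by
  ext a
  have hd := @Finset.disjoint_left _ x.ele y.ele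
  have h1 := @inp_subset x a
  have h2 := @inp_subset y a
  rw [mem_out, inp_arrow h]
  simp only [mem_out, Finset.mem_union, ele]
  have := @hd.1 h a
  tauto

theorem ele_ext (x : HOType) (E : Finset Sys) : (x.ext E).ele = x.ele ∪ E := by
  induction x with
  | elem A => rfl
  | arrow x y _ hy => simp only [ext, ele, hy, Finset.union_assoc]

theorem NonRep.ext {x : HOType} (hx : x.NonRep) {E : Finset Sys} (hE : Disjoint E x.ele) :
    (x.ext E).NonRep := by
  induction x with
  | elem A => trivial
  | arrow x y _ hy =>
    obtain ⟨h1, h2, h3⟩ := hx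
    simp only [ele, Finset.disjoint_union_right] at hE
    refine ⟨h1, hy h2 hE.2, ?_⟩
    rw [ele_ext, Finset.disjoint_union_right]
    exact ⟨h3, hE.1.symm⟩

end HOType

open HOType

/-! ### Deterministic kernels -/

/-- The kernels of the deterministic maps of a type, described without extensions: positive kernels
which map deterministic kernels to deterministic kernels. -/
def DetKer : HOType → Ker → Prop
  | elem A, F => Supp A F ∧ PSD F ∧ ptr A F = 1
  | arrow x y, F => Supp (x.ele ∪ y.ele) F ∧ PSD F ∧
      ∀ ρ, DetKer x ρ → DetKer y (contract x.ele (F * ρ))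

theorem DetKer.supp {x : HOType} {F : Ker} (h : DetKer x F) : Supp x.ele F := by
  cases x <;> exact h.1

theorem DetKer.psd {x : HOType} {F : Ker} (h : DetKer x F) : PSD F := by
  cases x <;> exact h.2.1

theorem DetKer.convex {x : HOType} {F G : Ker} (hF : DetKer x F) (hG : DetKer x G) {a b : ℝ}
    (ha : 0 ≤ a) (hb : 0 ≤ b) (hab : a + b = 1) : DetKer x ((a : ℂ) • F + (b : ℂ) • G) := by
  have ha' : (0 : ℂ) ≤ a := by exact_mod_cast ha
  have hb' : (0 : ℂ) ≤ b := by exact_mod_cast hb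
  have hs := (hF.supp.smul a).add (hG.supp.smul b)
  have hp := (hF.psd.smul ha').add (hG.psd.smul hb')
  induction x generalizing F G with
  | elem A =>
    refine ⟨hs, hp, ?_⟩
    rw [ptr_add, ptr_smul, ptr_smul, hF.2.2, hG.2.2, ← add_smul]
    rw [← Complex.ofReal_add, hab, Complex.ofReal_one, one_smul]
  | arrow x y _ hy =>
    refine ⟨hs, hp, fun ρ hρ => ?_⟩
    have h1 := hF.2.2 ρ hρ
    have h2 := hG.2.2 ρ hρ
    rw [add_mul, contract_add, smul_mul_assoc, smul_mul_assoc, contract_smul, contract_smul]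
    exact hy h1 h2 ((h1.supp.smul a).add (h2.supp.smul b))
      ((h1.psd.smul ha').add (h2.psd.smul hb'))

/-- Deterministic maps are channels from the inputs to the outputs of their type, and a state of
the outputs, together with the identity on the inputs, is a deterministic map. -/
theorem detKer_channel (x : HOType) (hx : x.NonRep) :
    (∀ F, DetKer x F → ptr x.out F = delta x.inp) ∧
    (∀ σ, Supp x.out σ → PSD σ → ptr x.out σ = 1 → DetKer x (delta x.inp * σ)) := by
  induction x with
  | elem A =>
    simp only [inp_elem, out_elem, delta_empty, one_mul]
    exact ⟨fun F hF => hF.2.2, fun σ h1 h2 h3 => ⟨h1, h2, h3⟩⟩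
  | arrow x y ihx ihy =>
    obtain ⟨hx, hy, hd⟩ := hx
    obtain ⟨ax, cx⟩ := ihx hx
    obtain ⟨ay, cy⟩ := ihy hy
    rw [inp_arrow hd, out_arrow hd]
    have d1 : Disjoint x.inp y.out := hd.mono x.inp_subset y.out_subset
    have d2 : Disjoint x.inp y.inp := hd.mono x.inp_subset y.inp_subset
    have d3 : Disjoint x.out y.inp := hd.mono x.out_subset y.inp_subset
    have d4 : Disjoint x.out y.out := hd.mono x.out_subset y.out_subset
    have dx := x.disjoint_inp_out
    have dy := y.disjoint_inp_out
    constructor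
    · intro F hF
      rw [← sub_eq_zero]
      refine eq_zero_of_contract_states (A := x.out) fun σ h1 h2 h3 => ?_
      rw [sub_mul, contract_sub, sub_eq_zero]
      have key := ay _ (hF.2.2 _ (cx σ h1 h2 h3))
      rw [ptr_contract_comm (hd.mono_right y.out_subset).symm, ptr_mul_right
        (B := x.ele) (((Supp.delta _).mono x.inp_subset).mul (h1.mono x.out_subset))
        (hd.mono_right y.out_subset), ← x.inp_union_out, Finset.union_comm,
        contract_union dx.symm, ← mul_assoc, contract_mul_right h1 dx.symm] at key
      rw [ptr_union d1, ptr, key, delta_union, mul_comm (delta x.out), mul_assoc,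
        contract_mul_left (Supp.delta _) d3.symm, mul_comm (delta x.out)]
      change _ = _ * ptr x.out σ
      rw [h3, mul_one]
    · intro σ h1 h2 h3
      refine ⟨?_, (PSD.delta _).mul h2, fun ρ hρ => ?_⟩
      · refine ((Supp.delta _).mono ?_).mul (h1.mono ?_)
        · exact Finset.union_subset_union x.out_subset y.inp_subset
        · exact Finset.union_subset_union x.inp_subset y.out_subset
      · have e : contract x.ele (delta (x.out ∪ y.inp) * σ * ρ) =
            delta y.inp * ptr x.inp σ := by
          rw [← x.inp_union_out, contract_union dx, delta_union]
          have : delta x.out * delta y.inp * σ * ρ =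
              (delta y.inp * σ) * (ρ * delta x.out) := by ring
          rw [this, contract_mul_left (A := y.inp ∪ (x.inp ∪ y.out))
            (((Supp.delta _).mono Finset.subset_union_left).mul
              (h1.mono Finset.subset_union_right))]
          · change contract x.inp (_ * ptr x.out ρ) = _
            rw [ax ρ hρ, mul_assoc, contract_mul_left (Supp.delta _) d2.symm]
            rfl
          · simp only [Finset.disjoint_union_left]
            exact ⟨d3.symm, dx, d4.symm⟩
        rw [e]
        refine cy _ ((h1.ptr _).mono ?_) (h2.ptr _) ?_
        · rw [Finset.union_sdiff_left]
          exact Finset.sdiff_subset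
        · rw [← ptr_union d1.symm, Finset.union_comm, h3]

theorem detKer_ext (x : HOType) {E : Finset Sys} (hE : Disjoint E x.ele) (F : Ker) :
    DetKer (x.ext E) F ↔ Supp (x.ele ∪ E) F ∧ PSD F ∧ DetKer x (ptr E F) := by
  induction x generalizing F with
  | elem A =>
    simp only [HOType.ext, ele, DetKer] at hE ⊢
    rw [ptr_union hE.symm]
    refine and_congr_right fun hs => and_congr_right fun hp => ?_
    have h1 := (hs.ptr E).mono (B := A) (by rw [Finset.union_sdiff_right]; exact Finset.sdiff_subset)
    have h2 := hp.ptr E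
    tauto
  | arrow x y _ ihy =>
    simp only [ele, Finset.disjoint_union_right] at hE
    simp only [HOType.ext, DetKer, ele, ele_ext, Finset.union_assoc]
    refine and_congr_right fun hs => and_congr_right fun hp => ?_
    have h1 := (hs.ptr E).mono (B := x.ele ∪ y.ele) (by
      rw [← Finset.union_assoc, Finset.union_sdiff_right]; exact Finset.sdiff_subset)
    have h2 := hp.ptr E
    simp only [h1, h2, true_and]
    refine forall_congr' fun ρ => forall_congr' fun hρ => ?_
    rw [ihy hE.2, ptr_contract_comm hE.1, ptr_mul_right hρ.supp hE.1.symm]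
    have h3 := ((hs.mul (hρ.supp.mono Finset.subset_union_left)).contract x.ele).mono
      (B := y.ele ∪ E) (by rw [Finset.union_sdiff_left]; exact Finset.sdiff_subset)
    have h4 := (hp.mul hρ.psd).contract x.ele
    tauto

/-! ### Admissible and deterministic maps of compound types -/

/-- Kernels of admissible maps: positive kernels dominated by a deterministic kernel. -/
def AdmKer (x : HOType) (F : Ker) : Prop :=
  Supp x.ele F ∧ PSD F ∧ ∃ N, DetKer x N ∧ PSD (N - F)

theorem DetKer.admKer {x : HOType} {F : Ker} (h : DetKer x F) : AdmKer x F :=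
  ⟨h.supp, h.psd, F, h, by rw [sub_self]; exact PSD.zero⟩

/-- All extensions of `F` preserve admissibility. -/
def CapKer (x y : HOType) (F : Ker) : Prop :=
  ∀ E : Finset Sys, Disjoint E (x.ele ∪ y.ele) → ∀ ρ, AdmKer (x.ext E) ρ →
    AdmKer (y.ext E) (contract x.ele (F * ρ))

/-- All extensions of `F` preserve determinism. -/
def CdpKer (x y : HOType) (F : Ker) : Prop :=
  ∀ E : Finset Sys, Disjoint E (x.ele ∪ y.ele) → ∀ ρ, DetKer (x.ext E) ρ →
    DetKer (y.ext E) (contract x.ele (F * ρ))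

theorem supp_contract_ext {x y : HOType} {E : Finset Sys} {F ρ : Ker}
    (hF : Supp (x.ele ∪ y.ele) F) (hρ : Supp (x.ext E).ele ρ) :
    Supp (y.ext E).ele (contract x.ele (F * ρ)) := by
  rw [ele_ext] at hρ ⊢
  refine (((hF.mono (B := x.ele ∪ (y.ele ∪ E)) ?_).mul (hρ.mono ?_)).contract x.ele).mono ?_
  · exact Finset.union_subset_union_right Finset.subset_union_left
  · exact Finset.union_subset_union_right Finset.subset_union_right
  · rw [Finset.union_sdiff_left]
    exact Finset.sdiff_subset

theorem DetKer.cdpKer {x y : HOType} {F : Ker} (hF : DetKer (arrow x y) F) : CdpKer x y F := by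
  intro E hE ρ hρ
  rw [Finset.disjoint_union_right] at hE
  have hs := supp_contract_ext hF.1 hρ.supp
  have hp := (hF.2.1.mul hρ.psd).contract x.ele
  rw [detKer_ext _ hE.1] at hρ
  rw [detKer_ext _ hE.2, ← ele_ext]
  refine ⟨hs, hp, ?_⟩
  rw [ptr_contract_comm hE.1, ptr_mul_left hF.1 (Finset.disjoint_union_left.2 ⟨hE.1.symm, hE.2.symm⟩)]
  exact hF.2.2 _ hρ.2.2

theorem CdpKer.detKer {x y : HOType} {F : Ker} (hs : Supp (x.ele ∪ y.ele) F) (hp : PSD F)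
    (hF : CdpKer x y F) : DetKer (arrow x y) F := by
  refine ⟨hs, hp, fun ρ hρ => ?_⟩
  have h := hF ∅ (Finset.disjoint_empty_left _) ρ ((detKer_ext _ (Finset.disjoint_empty_left _) _).2
    ⟨hρ.supp.mono Finset.subset_union_left, hρ.psd, by rwa [ptr_empty]⟩)
  rw [detKer_ext _ (Finset.disjoint_empty_left _), ptr_empty] at h
  exact h.2.2

theorem AdmKer.capKer {x y : HOType} {F : Ker} (hF : AdmKer (arrow x y) F) : CapKer x y F := by
  obtain ⟨hs, hp, N, hN, hd⟩ := hF
  rintro E hE ρ ⟨hρs, hρp, σ, hσ, hσρ⟩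
  refine ⟨supp_contract_ext hs hρs, (hp.mul hρp).contract _, _, hN.cdpKer E hE σ hσ, ?_⟩
  have : N * σ - F * ρ = N * (σ - ρ) + (N - F) * ρ := by ring
  rw [← contract_sub, this]
  exact ((hN.psd.mul hσρ).add (hd.mul hρp)).contract _

/-- There are ancillary systems of arbitrarily large dimension. -/
theorem exists_embedding (A B : Finset Sys) :
    ∃ E : Finset Sys, Disjoint E B ∧ ∃ e : Idx A → Idx E, Injective e := by
  obtain ⟨n, hn⟩ := Infinite.exists_notMem_finset (B.image Sys.name)
  have hd : 2 ≤ Fintype.card (Idx A) + 2 := by omega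
  refine ⟨{⟨Fintype.card (Idx A) + 2, hd, n⟩}, ?_, ?_⟩
  · rw [Finset.disjoint_singleton_left]
    exact fun h => hn (Finset.mem_image.2 ⟨_, h, rfl⟩)
  · have key : ∀ s : Sys, Fintype.card (Idx A) ≤ s.dim →
        ∃ e : Idx A → Idx {s}, Injective e := by
      intro s hs
      refine ⟨fun a i => Fin.cast (by rw [Finset.mem_singleton.1 i.2])
        (Fin.castLE hs (Fintype.equivFin _ a)), fun a b hab => ?_⟩
      have := congrFun hab ⟨s, Finset.mem_singleton_self s⟩
      simpa using this
    exact key _ (by simp)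

theorem smul_delta_detKer {x : HOType} (hx : x.NonRep) :
    DetKer x (((Fintype.card (Idx x.out) : ℂ)⁻¹) • delta x.ele) := by
  have hc : (Fintype.card (Idx x.out) : ℂ) ≠ 0 := by
    exact_mod_cast (Fintype.card_pos_iff.2 ⟨res x.out default⟩).ne'
  have := (detKer_channel x hx).2 (((Fintype.card (Idx x.out) : ℂ)⁻¹) • delta x.out)
    ((Supp.delta _).smul _) ((PSD.delta _).smul (inv_nonneg.2 (Nat.cast_nonneg _))) (by
      rw [ptr_smul, ptr_delta]
      funext k l
      exact inv_mul_cancel₀ hc)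
  rwa [mul_smul_comm, ← delta_union, inp_union_out] at this

theorem CapKer.psd {x y : HOType} (hx : x.NonRep) {F : Ker} (hs : Supp (x.ele ∪ y.ele) F)
    (hF : CapKer x y F) : PSD F := by
  obtain ⟨E, hE, e, he⟩ := exists_embedding x.ele (x.ele ∪ y.ele)
  have hEx := (Finset.disjoint_union_right.1 hE).1
  set c : ℂ := (Fintype.card (Idx x.out) : ℂ)⁻¹ with hc
  have hc0 : c ≠ 0 := inv_ne_zero (by
    exact_mod_cast (Fintype.card_pos_iff.2 ⟨res x.out default⟩).ne')
  have hcn : 0 ≤ c := inv_nonneg.2 (Nat.cast_nonneg _)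
  let v : Glob → ℂ := fun k => if res E k = e (res x.ele k) then 1 else 0
  let Ω : Ker := fun k l => v k * star (v l)
  have hΩs : Supp (x.ele ∪ E) Ω := by
    intro k k' l l' hk hl
    have h : ∀ {a b : Glob}, (∀ i ∈ x.ele ∪ E, a i = b i) → v a = v b := by
      intro a b hab
      have h1 : res E a = res E b := funext fun i => hab i.1 (Finset.mem_union_right _ i.2)
      have h2 : res x.ele a = res x.ele b := funext fun i => hab i.1 (Finset.mem_union_left _ i.2)
      simp only [v, h1, h2]
    simp only [Ω, h hk, h hl]
  have hΩp : PSD Ω := PSD.rankOne v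
  have hvE : ∀ k h, v (upd k E h) = if h = e (res x.ele k) then 1 else 0 := by
    intro k h
    have : res x.ele (upd k E h) = res x.ele k := by
      funext i
      simp [res, updateFinset, Finset.disjoint_right.1 hEx i.2]
    simp only [v, res_upd, this]
  have hΩt : ptr E Ω = delta x.ele := by
    funext k l
    have hkl : (∀ i ∈ x.ele, k i = l i) ↔ e (res x.ele k) = e (res x.ele l) := by
      rw [he.eq_iff]
      exact ⟨fun H => funext fun i => H i.1 i.2, fun H i hi => congrFun H ⟨i, hi⟩⟩
    simp only [ptr_apply, Ω, hvE, delta, hkl]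
    simp [eq_comm]
  have hdet : DetKer (x.ext E) (c • Ω) := by
    rw [detKer_ext _ hEx, ptr_smul, hΩt]
    exact ⟨hΩs.smul c, hΩp.smul hcn, smul_delta_detKer hx⟩
  have h1 := (hF E hE _ hdet.admKer).2.1
  rw [mul_smul_comm, contract_smul] at h1
  have h2 := h1.smul (inv_nonneg.2 hcn)
  rw [smul_smul, inv_mul_cancel₀ hc0, one_smul] at h2
  have h3 := h2.comp fun g => upd g E (e (res x.ele g))
  convert h3 using 1
  funext k l
  have hvx : ∀ g h, v (upd (upd g E (e (res x.ele g))) x.ele h) =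
      if h = res x.ele g then 1 else 0 := by
    intro g h
    have : res E (upd (upd g E (e (res x.ele g))) x.ele h) = e (res x.ele g) := by
      funext i
      simp [res, updateFinset, Finset.disjoint_left.1 hEx i.2]
    simp only [v, res_upd, this, he.eq_iff, eq_comm]
  have hup : ∀ g, ∀ i ∈ x.ele ∪ y.ele,
      g i = upd (upd g E (e (res x.ele g))) x.ele (res x.ele g) i := by
    intro g i hi
    have := Finset.disjoint_right.1 hE hi
    simp [res, updateFinset, this]
  simp only [contract, Pi.mul_apply, Ω, hvx]
  simpa using hs (hup k) (hup l)

/-! ### Characterization of deterministic and admissible maps -/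

theorem inter_ele_ext {x y : HOType} {E : Finset Sys} (hd : Disjoint x.ele y.ele)
    (hE : Disjoint E (x.ele ∪ y.ele)) : (x.ele ∪ y.ele) ∩ (x.ext E).ele = x.ele := by
  rw [ele_ext]
  ext a
  have h1 : a ∈ E → a ∉ x.ele ∪ y.ele := fun h => Finset.disjoint_left.1 hE h
  have h2 : a ∈ x.ele → a ∉ y.ele := fun h => Finset.disjoint_left.1 hd h
  simp only [Finset.mem_inter, Finset.mem_union] at h1 ⊢
  tauto

theorem link_ele_ext {x y : HOType} {E : Finset Sys} (hd : Disjoint x.ele y.ele)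
    (hE : Disjoint E (x.ele ∪ y.ele)) :
    ((x.ele ∪ y.ele) ∪ (x.ext E).ele) \ ((x.ele ∪ y.ele) ∩ (x.ext E).ele) = (y.ext E).ele := by
  rw [inter_ele_ext hd hE, ele_ext, ele_ext]
  ext a
  have h1 : a ∈ E → a ∉ x.ele ∪ y.ele := fun h => Finset.disjoint_left.1 hE h
  have h2 : a ∈ x.ele → a ∉ y.ele := fun h => Finset.disjoint_left.1 hd h
  simp only [Finset.mem_sdiff, Finset.mem_union] at h1 ⊢
  tauto

/-- Translation of preservation properties of operators to kernels. -/
theorem preserve_iff {x y : HOType} {E : Finset Sys} (hd : Disjoint x.ele y.ele)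
    (hE : Disjoint E (x.ele ∪ y.ele)) {P Q : (A : Finset Sys) → Op A → Prop} {P' Q' : Ker → Prop}
    (hP : ∀ A M, P A M ↔ A = (x.ext E).ele ∧ P' (lift M))
    (hQ : ∀ A M, Q A M ↔ A = (y.ext E).ele ∧ Q' (lift M))
    (hs : ∀ ρ, P' ρ → Supp (x.ext E).ele ρ) (M : Op (x.ele ∪ y.ele)) :
    (∀ (B : Finset Sys) (ρ : Op B), P B ρ → Q _ (link M ρ)) ↔
      ∀ ρ, P' ρ → Q' (contract x.ele (lift M * ρ)) := by
  constructor
  · intro h ρ hρ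
    obtain ⟨ρ, rfl⟩ := (hs _ hρ).exists_lift
    have := ((hQ _ _).1 (h _ ρ ((hP _ _).2 ⟨rfl, hρ⟩))).2
    rwa [lift_link, inter_ele_ext hd hE] at this
  · intro h B ρ hρ
    obtain ⟨rfl, hρ⟩ := (hP _ _).1 hρ
    refine (hQ _ _).2 ⟨link_ele_ext hd hE, ?_⟩
    rw [lift_link, inter_ele_ext hd hE]
    exact h _ hρ

theorem adm_det_iff (n : ℕ) : ∀ x : HOType, x.arrows = n → x.NonRep →
    (∀ (A : Finset Sys) (M : Op A), Adm x A M ↔ A = x.ele ∧ AdmKer x (lift M)) ∧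
    (∀ (A : Finset Sys) (M : Op A), Det x A M ↔ A = x.ele ∧ DetKer x (lift M)) := by
  induction n using Nat.strong_induction_on with
  | _ n ih =>
  intro x hn hx
  cases x with
  | elem B =>
    have hdet : ∀ M : Op B, DetKer (elem B) (lift M) ↔ M.PosSemidef ∧ M.trace = 1 := by
      intro M
      have : ptr B (lift M) = 1 ↔ M.trace = 1 := by
        rw [ptr, trace_lift]
        exact ⟨fun h => congrFun (congrFun h default) default, fun h => by rw [h]; rfl⟩
      simp only [DetKer, lift_supp, true_and, psd_lift_iff, this]
    constructor
    · intro A M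
      rw [Adm]
      refine and_congr_right fun hA => ?_
      subst hA
      simp only [AdmKer, ele, lift_supp, true_and, psd_lift_iff]
      refine and_congr_right fun _ => ⟨?_, ?_⟩
      · rintro ⟨N, h1, h2, h3⟩
        exact ⟨lift N, (hdet N).2 ⟨h1, h2⟩, (psd_lift_iff (M := N - M)).2 h3⟩
      · rintro ⟨N, h1, h2⟩
        obtain ⟨N, rfl⟩ := Supp.exists_lift (A := A) h1.supp
        exact ⟨N, ((hdet N).1 h1).1, ((hdet N).1 h1).2, (psd_lift_iff (M := N - M)).1 h2⟩
    · intro A M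
      rw [Det]
      refine and_congr_right fun hA => ?_
      subst hA
      exact (hdet M).symm
  | arrow x y =>
    obtain ⟨hx, hy, hd⟩ := hx
    simp only [arrows] at hn
    have ihx : ∀ E : Finset Sys, Disjoint E (x.ele ∪ y.ele) → _ := fun E hE =>
      ih (x.ext E).arrows (by rw [arrows_ext]; omega) (x.ext E) rfl
        (hx.ext (Finset.disjoint_union_right.1 hE).1)
    have ihy : ∀ E : Finset Sys, Disjoint E (x.ele ∪ y.ele) → _ := fun E hE =>
      ih (y.ext E).arrows (by rw [arrows_ext]; omega) (y.ext E) rfl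
        (hy.ext (Finset.disjoint_union_right.1 hE).2)
    have hcap : ∀ M : Op (x.ele ∪ y.ele),
        (∀ E : Finset Sys, Disjoint E (x.ele ∪ y.ele) → ∀ (B : Finset Sys) (ρ : Op B),
          Adm (x.ext E) B ρ → Adm (y.ext E) _ (link M ρ)) ↔ CapKer x y (lift M) := fun M =>
      forall₂_congr fun E hE =>
        preserve_iff hd hE (ihx E hE).1 (ihy E hE).1 (fun _ h => h.1) M
    have hcdp : ∀ M : Op (x.ele ∪ y.ele),
        (∀ E : Finset Sys, Disjoint E (x.ele ∪ y.ele) → ∀ (B : Finset Sys) (ρ : Op B),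
          Det (x.ext E) B ρ → Det (y.ext E) _ (link M ρ)) ↔ CdpKer x y (lift M) := fun M =>
      forall₂_congr fun E hE =>
        preserve_iff hd hE (ihx E hE).2 (ihy E hE).2 (fun _ h => h.supp) M
    have hadm : ∀ (A : Finset Sys) (M : Op A), Adm (arrow x y) A M ↔
        A = (arrow x y).ele ∧ AdmKer (arrow x y) (lift M) := by
      intro A M
      rw [Adm]
      refine and_congr_right fun hA => ?_
      replace hA : A = x.ele ∪ y.ele := hA
      subst hA
      simp only [hcap, hcdp]
      constructor
      · rintro ⟨h1, n, N, h2, h3⟩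
        have hM := h1.psd hx (lift_supp M)
        have hN : PSD (lift (∑ i, N i)) := psd_lift_iff.2
          (Matrix.posSemidef_sum _ fun i _ => psd_lift_iff.1 ((h2 i).psd hx (lift_supp _)))
        refine ⟨lift_supp M, hM, _, CdpKer.detKer (lift_supp _) ?_ h3, ?_⟩
        · rw [lift_add]
          exact hM.add hN
        · rwa [lift_add, add_sub_cancel_left]
      · intro hM
        refine ⟨hM.capKer, ?_⟩
        obtain ⟨h1, h2, N, h3, h4⟩ := hM
        obtain ⟨N, rfl⟩ := Supp.exists_lift (A := x.ele ∪ y.ele) h3.supp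
        refine ⟨1, fun _ => N - M, fun _ => ?_, ?_⟩
        · refine AdmKer.capKer ⟨lift_supp _, h4, lift N, h3, ?_⟩
          rw [lift_sub, sub_sub_cancel]
          exact h2
        · rw [Fin.sum_const, one_smul, add_sub_cancel]
          exact h3.cdpKer
    refine ⟨hadm, fun A M => ?_⟩
    rw [Det, hadm, and_assoc]
    refine and_congr_right fun hA => ?_
    replace hA : A = x.ele ∪ y.ele := hA
    subst hA
    rw [hcdp]
    exact ⟨fun h => CdpKer.detKer (lift_supp _) h.1.2.1 h.2, fun h => ⟨h.admKer, h.cdpKer⟩⟩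

theorem det_iff {x : HOType} (hx : x.NonRep) {A : Finset Sys} {M : Op A} :
    Det x A M ↔ A = x.ele ∧ DetKer x (lift M) :=
  (adm_det_iff _ x rfl hx).2 A M

/-! ### Pure product outputs -/

/-- The projection on the basis vector with label `f`. -/
def pureKer (f : Glob) (A : Finset Sys) : Ker := fun k l =>
  (if ∀ i ∈ A, k i = f i then 1 else 0) * star (if ∀ i ∈ A, l i = f i then 1 else 0)

theorem supp_pureKer (f : Glob) (A : Finset Sys) : Supp A (pureKer f A) :=
  fun k k' l l' hk hl => by
    have h1 : (∀ i ∈ A, k i = f i) ↔ (∀ i ∈ A, k' i = f i) :=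
      forall₂_congr fun i hi => by rw [hk i hi]
    have h2 : (∀ i ∈ A, l i = f i) ↔ (∀ i ∈ A, l' i = f i) :=
      forall₂_congr fun i hi => by rw [hl i hi]
    simp only [pureKer, h1, h2]

theorem ptr_pureKer (f : Glob) (A : Finset Sys) : ptr A (pureKer f A) = 1 := by
  funext k l
  have h : ∀ (k : Glob) (h : Idx A), (∀ i ∈ A, upd k A h i = f i) ↔ h = res A f := by
    intro k h
    constructor
    · intro H
      funext i
      simpa [updateFinset, res] using H i.1 i.2
    · rintro rfl i hi
      simp [updateFinset, hi, res]
  simp only [ptr_apply, pureKer, h]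
  simp

/-- The deterministic kernel which discards the inputs and prepares the pure outputs `f`. -/
def prepKer (x : HOType) (f : Glob) : Ker := delta x.inp * pureKer f x.out

theorem prepKer_detKer {x : HOType} (hx : x.NonRep) (f : Glob) : DetKer x (prepKer x f) :=
  (detKer_channel x hx).2 _ (supp_pureKer _ _) (PSD.rankOne _) (ptr_pureKer _ _)

/-- The condition for a matrix entry of `prepKer x f` to be nonzero. -/
def PrepCond (x : HOType) (f k l : Glob) : Prop :=
  (∀ i ∈ x.inp, k i = l i) ∧ (∀ i ∈ x.out, k i = f i) ∧ (∀ i ∈ x.out, l i = f i)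

open scoped Classical in
theorem prepKer_apply (x : HOType) (f k l : Glob) :
    prepKer x f k l = if PrepCond x f k l then 1 else 0 := by
  by_cases h : PrepCond x f k l
  · rw [if_pos h]
    obtain ⟨h1, h2, h3⟩ := h
    simp only [prepKer, Pi.mul_apply, delta, pureKer]
    rw [if_pos h1, if_pos h2, if_pos h3]
    simp
  · rw [if_neg h]
    simp only [prepKer, Pi.mul_apply, delta, pureKer]
    by_contra hne
    refine h ⟨?_, ?_, ?_⟩ <;> by_contra hc <;> refine hne ?_ <;> rw [if_neg hc] <;> simp

theorem existsUnique_of_ptr_eq {x y : HOType} {f g : Glob} {H K V : Finset Sys}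
    (h : ptr V (contract H (prepKer x f * prepKer y g)) = delta K) (k : Glob) :
    ∃! p : Idx V × Idx H × Idx H,
      PrepCond x f (upd (upd k V p.1) H p.2.1) (upd (upd k V p.1) H p.2.2) ∧
      PrepCond y g (upd (upd k V p.1) H p.2.1) (upd (upd k V p.1) H p.2.2) := by
  classical
  have h1 := congrFun (congrFun h k) k
  simp only [ptr_apply, contract, Pi.mul_apply, prepKer_apply, ite_zero_mul_ite_zero, mul_one] at h1
  rw [delta, if_pos fun _ _ => rfl] at h1
  simp only [← Fintype.sum_prod_type'] at h1
  rw [Finset.sum_boole] at h1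
  have h2 := Finset.card_eq_one.1 (by exact_mod_cast h1)
  obtain ⟨p, hp⟩ := h2
  refine ⟨p, ?_, fun q hq => ?_⟩
  · have := hp ▸ Finset.mem_singleton_self p
    exact (Finset.mem_filter.1 this).2
  · exact Finset.mem_singleton.1 (hp ▸ Finset.mem_filter.2 ⟨Finset.mem_univ _, hq⟩)

theorem exists_update_ne (f : Glob) (a : Sys) :
    ∃ f' : Glob, f' a ≠ f a ∧ ∀ i, i ≠ a → f' i = f i := by
  have := Fin.nontrivial_iff_two_le.2 a.two_le_dim
  obtain ⟨b, hb⟩ := exists_ne (f a)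
  exact ⟨update f a b, by simpa using hb, fun i hi => by simp [hi]⟩

theorem prepCond_of_notMem {x : HOType} {f f' : Glob} {a : Sys} (ha : a ∉ x.out)
    (hf : ∀ i, i ≠ a → f' i = f i) : PrepCond x f f' f' := by
  have : ∀ i ∈ x.out, f' i = f i := fun i hi => hf i fun h => ha (h ▸ hi)
  exact ⟨fun _ _ => rfl, this, this⟩

theorem prepCond_self (x : HOType) (f : Glob) : PrepCond x f f f :=
  ⟨fun _ _ => rfl, fun _ _ => rfl, fun _ _ => rfl⟩

theorem upd_res_of_eq_off {f f' : Glob} {a : Sys} {A : Finset Sys} (ha : a ∈ A)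
    (hf : ∀ i, i ≠ a → f' i = f i) : upd f A (res A f') = f' := by
  funext i
  by_cases hi : i ∈ A
  · simp [updateFinset, hi, res]
  · simp [updateFinset, hi, hf i fun h => hi (h ▸ ha)]

theorem upd_res_of_notMem {f f' : Glob} {a : Sys} {A : Finset Sys} (ha : a ∉ A)
    (hf : ∀ i, i ≠ a → f' i = f i) : upd f' A (res A f) = f' := by
  funext i
  by_cases hi : i ∈ A
  · simp [updateFinset, hi, res, hf i fun h => ha (h ▸ hi)]
  · simp [updateFinset, hi]

/-- The systems of the composition of `x` and `y`. -/
def compEle (x y : HOType) : Finset Sys := (x.ele ∪ y.ele) \ (x.ele ∩ y.ele)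

theorem compOut_eq (x y : HOType) : compOut x y = compEle x y \ compIn x y := by
  ext a
  have h1 := @inp_subset x a
  have h2 := @inp_subset y a
  simp only [compOut, compEle, compIn, Finset.mem_sdiff, Finset.mem_union, Finset.mem_inter,
    mem_out]
  tauto

theorem compIn_subset (x y : HOType) : compIn x y ⊆ compEle x y :=
  Finset.sdiff_subset_sdiff (Finset.union_subset_union x.inp_subset y.inp_subset) subset_rfl

theorem disjoint_compIn_compOut (x y : HOType) : Disjoint (compIn x y) (compOut x y) := by
  rw [compOut_eq]
  exact Finset.disjoint_sdiff

theorem compIn_union_compOut (x y : HOType) : compIn x y ∪ compOut x y = compEle x y := by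
  rw [compOut_eq]
  exact Finset.union_sdiff_of_subset (compIn_subset x y)

theorem not_both_out {x y : HOType} {f g : Glob} {K V : Finset Sys} {a : Sys}
    (hx : a ∈ x.out) (hy : a ∈ y.out)
    (h : ptr V (contract (x.ele ∩ y.ele) (prepKer x f * prepKer y g)) = delta K) :
    f a = g a := by
  obtain ⟨p, ⟨h1, h2⟩, -⟩ := existsUnique_of_ptr_eq h f
  exact (h1.2.1 a hx).symm.trans (h2.2.1 a hy)

theorem not_both_inp {x y : HOType} {f : Glob} {K V : Finset Sys} {a : Sys}
    (hx : a ∈ x.inp) (hy : a ∈ y.inp)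
    (h : ptr V (contract (x.ele ∩ y.ele) (prepKer x f * prepKer y f)) = delta K) : False := by
  obtain ⟨f', hne, hf⟩ := exists_update_ne f a
  have ha : a ∈ x.ele ∩ y.ele := Finset.mem_inter.2 ⟨x.inp_subset hx, y.inp_subset hy⟩
  have hu := (existsUnique_of_ptr_eq h f).unique
    (y₁ := (res V f, res _ f, res _ f)) (y₂ := (res V f, res _ f', res _ f'))
    (by simp only [upd_res]; exact ⟨prepCond_self _ _, prepCond_self _ _⟩) (by
      simp only [upd_res, upd_res_of_eq_off ha hf]
      exact ⟨prepCond_of_notMem (Finset.disjoint_left.1 x.disjoint_inp_out hx) hf,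
        prepCond_of_notMem (Finset.disjoint_left.1 y.disjoint_inp_out hy) hf⟩)
  have := congrFun (congrArg (fun p => p.2.1) hu) ⟨a, ha⟩
  exact hne this.symm

theorem eq_compIn_of_ptr_eq {x y : HOType} {f : Glob} {K : Finset Sys} (hK : K ⊆ compEle x y)
    (h : ptr (compEle x y \ K) (contract (x.ele ∩ y.ele) (prepKer x f * prepKer y f)) = delta K) :
    K = compIn x y := by
  apply Finset.Subset.antisymm
  · intro a ha
    by_contra hni
    have hU := hK ha
    have hV : a ∉ compEle x y \ K := fun h => (Finset.mem_sdiff.1 h).2 ha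
    have hH : a ∉ x.ele ∩ y.ele := (Finset.mem_sdiff.1 hU).2
    have hout : a ∈ compOut x y := by
      rw [compOut_eq]
      exact Finset.mem_sdiff.2 ⟨hU, hni⟩
    obtain ⟨f', hne, -⟩ := exists_update_ne f a
    obtain ⟨p, ⟨h1, h2⟩, -⟩ := existsUnique_of_ptr_eq h f'
    have hp : upd (upd f' (compEle x y \ K) p.1) (x.ele ∩ y.ele) p.2.1 a = f' a := by
      simp only [upd, updateFinset, hV, hH, dif_neg, not_false_iff]
    rcases Finset.mem_union.1 (Finset.mem_sdiff.1 hout).1 with h | h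
    · exact hne (hp.symm.trans (h1.2.1 a h))
    · exact hne (hp.symm.trans (h2.2.1 a h))
  · intro a ha
    by_contra hni
    have hU := compIn_subset x y ha
    have hV : a ∈ compEle x y \ K := Finset.mem_sdiff.2 ⟨hU, hni⟩
    have hH : a ∉ x.ele ∩ y.ele := (Finset.mem_sdiff.1 hU).2
    have hout := Finset.disjoint_left.1 (disjoint_compIn_compOut x y) ha
    have hox : a ∉ x.out := fun h =>
      hout (Finset.mem_sdiff.2 ⟨Finset.mem_union_left _ h, hH⟩)
    have hoy : a ∉ y.out := fun h =>
      hout (Finset.mem_sdiff.2 ⟨Finset.mem_union_right _ h, hH⟩)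
    obtain ⟨f', hne, hf⟩ := exists_update_ne f a
    have hu := (existsUnique_of_ptr_eq h f).unique
      (y₁ := (res _ f, res _ f, res _ f)) (y₂ := (res _ f', res _ f, res _ f))
      (by simp only [upd_res]; exact ⟨prepCond_self _ _, prepCond_self _ _⟩) (by
        simp only [upd_res_of_eq_off hV hf, upd_res_of_notMem hH hf]
        exact ⟨prepCond_of_notMem hox hf, prepCond_of_notMem hoy hf⟩)
    have := congrFun (congrArg (fun p => p.1) hu) ⟨a, hV⟩
    exact hne this.symm

/-! ### Admissible compositions -/

/-- The composition of deterministic kernels is a channel with some set `K` of inputs. -/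
theorem AdmissibleComp.exists_channel {x y : HOType} (h : AdmissibleComp x y) (hx : x.NonRep)
    (hy : y.NonRep) {F G : Ker} (hF : DetKer x F) (hG : DetKer y G) :
    ∃ K ⊆ compEle x y,
      ptr (compEle x y \ K) (contract (x.ele ∩ y.ele) (F * G)) = delta K := by
  obtain ⟨R, rfl⟩ := hF.supp.exists_lift
  obtain ⟨S, rfl⟩ := hG.supp.exists_lift
  obtain ⟨z, hz, hd⟩ := h R S ((det_iff hx).2 ⟨rfl, hF⟩) ((det_iff hy).2 ⟨rfl, hG⟩)
  obtain ⟨he, hd⟩ := (det_iff hz).1 hd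
  replace he : compEle x y = z.ele := he
  rw [lift_link] at hd
  refine ⟨z.inp, he ▸ z.inp_subset, ?_⟩
  rw [he]
  exact (detKer_channel z hz).1 _ hd

theorem eq_of_infinite_zeros {a b d e : ℂ} {s : Set ℝ} (hs : s.Infinite)
    (h : ∀ t ∈ s, ((1 - t : ℝ) : ℂ) * ((1 - t : ℝ) : ℂ) * a + ((1 - t : ℝ) : ℂ) * (t : ℂ) * b +
      (t : ℂ) * (t : ℂ) * d = e) : a = e ∧ d = e := by
  open Polynomial in
  have hp : ((1 - X) * (1 - X) * C a + (1 - X) * X * C b + X * X * C d - C e : ℂ[X]) = 0 := by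
    refine Polynomial.eq_zero_of_infinite_isRoot _
      ((hs.image Complex.ofReal_injective.injOn).mono ?_)
    rintro _ ⟨t, ht, rfl⟩
    have := h t ht
    simp only [Set.mem_ofPred_eq, Polynomial.IsRoot, Polynomial.eval_sub, Polynomial.eval_add,
      Polynomial.eval_mul, Polynomial.eval_one, Polynomial.eval_X, Polynomial.eval_C]
    rw [← this]
    push_cast
    ring
  constructor
  · have := congrArg (Polynomial.eval 0) hp
    simp at this
    linear_combination this
  · have := congrArg (Polynomial.eval 1) hp
    simp at this
    linear_combination this

theorem AdmissibleComp.ptr_compOut {x y : HOType} (h : AdmissibleComp x y) (hx : x.NonRep)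
    (hy : y.NonRep) {F G : Ker} (hF : DetKer x F) (hG : DetKer y G) :
    ptr (compOut x y) (contract (x.ele ∩ y.ele) (F * G)) = delta (compIn x y) := by
  have f : Glob := default
  set F₀ := prepKer x f
  set G₀ := prepKer y f
  have hF₀ : DetKer x F₀ := prepKer_detKer hx f
  have hG₀ : DetKer y G₀ := prepKer_detKer hy f
  let Ft : ℝ → Ker := fun t => ((1 - t : ℝ) : ℂ) • F₀ + (t : ℂ) • F
  let Gt : ℝ → Ker := fun t => ((1 - t : ℝ) : ℂ) • G₀ + (t : ℂ) • G
  let good : Finset Sys → Set ℝ := fun K =>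
    {t | ptr (compEle x y \ K) (contract (x.ele ∩ y.ele) (Ft t * Gt t)) = delta K}
  have hcover : Set.Icc (0 : ℝ) 1 ⊆ ⋃ K ∈ (compEle x y).powerset, good K := by
    rintro t ⟨h0, h1⟩
    obtain ⟨K, hK, e⟩ := h.exists_channel hx hy
      (hF₀.convex hF (sub_nonneg.2 h1) h0 (sub_add_cancel 1 t))
      (hG₀.convex hG (sub_nonneg.2 h1) h0 (sub_add_cancel 1 t))
    exact Set.mem_biUnion (Finset.mem_coe.2 (Finset.mem_powerset.2 hK)) e
  obtain ⟨K, hK, hinf⟩ : ∃ K ⊆ compEle x y, (good K).Infinite := by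
    by_contra! hcon
    refine Set.Icc_infinite (zero_lt_one (α := ℝ)) (Set.Finite.subset ?_ hcover)
    exact Set.Finite.biUnion (Finset.finite_toSet _) fun K hK =>
      hcon K (Finset.mem_powerset.1 (Finset.mem_coe.1 hK))
  have key : ∀ k l,
      ptr (compEle x y \ K) (contract (x.ele ∩ y.ele) (F₀ * G₀)) k l = delta K k l ∧
      ptr (compEle x y \ K) (contract (x.ele ∩ y.ele) (F * G)) k l = delta K k l := by
    intro k l
    refine eq_of_infinite_zeros hinf (b :=
      ptr (compEle x y \ K) (contract (x.ele ∩ y.ele) (F₀ * G + F * G₀)) k l) fun t ht => ?_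
    have e : Ft t * Gt t = (((1 - t : ℝ) : ℂ) * ((1 - t : ℝ) : ℂ)) • (F₀ * G₀) +
        (((1 - t : ℝ) : ℂ) * (t : ℂ)) • (F₀ * G + F * G₀) + ((t : ℂ) * (t : ℂ)) • (F * G) := by
      funext k l
      simp only [Ft, Gt, Pi.mul_apply, Pi.add_apply, Pi.smul_apply, smul_eq_mul]
      ring
    have ht' := congrFun (congrFun (show ptr _ _ = _ from ht) k) l
    rw [e] at ht'
    simpa only [contract_add, contract_smul, ptr_add, ptr_smul, Pi.add_apply, Pi.smul_apply,
      smul_eq_mul] using ht'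
  have hKin : K = compIn x y :=
    eq_compIn_of_ptr_eq (f := f) hK (funext fun k => funext fun l => (key k l).1)
  rw [compOut_eq, ← hKin]
  exact funext fun k => funext fun l => (key k l).2

/-- Positive kernels that satisfy the normalization of channels are deterministic. -/
theorem detKer_of_channel {A B : Finset Sys} (hd : Disjoint A B) {F : Ker}
    (hs : Supp (A ∪ B) F) (hp : PSD F) (h : ptr B F = delta A) :
    DetKer (arrow (elem A) (elem B)) F := by
  refine ⟨hs, hp, fun ρ hρ => ⟨?_, (hp.mul hρ.psd).contract _, ?_⟩⟩
  · refine ((hs.mul (hρ.supp.mono Finset.subset_union_left)).contract _).mono ?_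
    change (A ∪ B) \ A ⊆ B
    rw [Finset.union_sdiff_left]
    exact Finset.sdiff_subset
  · change ptr B (contract A (F * ρ)) = 1
    rw [ptr_contract_comm hd.symm, ptr_mul_right hρ.supp hd, h, mul_comm]
    exact hρ.2.2

theorem admissibleComp_iff {x y : HOType} (hx : x.NonRep) (hy : y.NonRep) :
    AdmissibleComp x y ↔
      (x.ele ∩ y.ele ⊆ (x.inp ∩ y.out) ∪ (x.out ∩ y.inp)) ∧
      ∀ (R : Op x.ele) (S : Op y.ele), Det x x.ele R → Det y y.ele S →
        Det (arrow (elem (compIn x y)) (elem (compOut x y))) _ (link R S) := by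
  have hz : (arrow (elem (compIn x y)) (elem (compOut x y))).NonRep :=
    ⟨trivial, trivial, disjoint_compIn_compOut x y⟩
  constructor
  · intro h
    refine ⟨fun a ha => ?_, fun R S hR hS => ?_⟩
    · obtain ⟨hax, hay⟩ := Finset.mem_inter.1 ha
      rw [← x.inp_union_out] at hax
      rw [← y.inp_union_out] at hay
      simp only [Finset.mem_union, Finset.mem_inter]
      rcases Finset.mem_union.1 hax with h1 | h1 <;> rcases Finset.mem_union.1 hay with h2 | h2
      · obtain ⟨K, -, e⟩ := h.exists_channel hx hy (prepKer_detKer hx default)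
          (prepKer_detKer hy default)
        exact (not_both_inp h1 h2 e).elim
      · exact Or.inl ⟨h1, h2⟩
      · exact Or.inr ⟨h1, h2⟩
      · obtain ⟨f, hf, -⟩ := exists_update_ne default a
        obtain ⟨K, -, e⟩ := h.exists_channel hx hy (prepKer_detKer hx f)
          (prepKer_detKer hy default)
        exact (hf (not_both_out h1 h2 e)).elim
    · have hR' := ((det_iff hx).1 hR).2
      have hS' := ((det_iff hy).1 hS).2
      refine (det_iff hz).2 ⟨(compIn_union_compOut x y).symm, ?_⟩
      refine detKer_of_channel (disjoint_compIn_compOut x y) ?_ ?_ ?_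
      · rw [compIn_union_compOut]
        exact lift_supp _
      · rw [lift_link]
        exact (hR'.psd.mul hS'.psd).contract _
      · rw [lift_link]
        exact h.ptr_compOut hx hy hR' hS'
  · rintro ⟨-, h⟩ R S hR hS
    exact ⟨_, hz, h R S hR hS⟩

end HOQ

theorem mainTheorem3 (x y : HOQ.HOType) (hx : x.NonRep) (hy : y.NonRep) :
    HOQ.AdmissibleComp x y ↔
      (x.ele ∩ y.ele ⊆ (x.inp ∩ y.out) ∪ (x.out ∩ y.inp)) ∧
      ∀ (R : HOQ.Op x.ele) (S : HOQ.Op y.ele), HOQ.Det x x.ele R → HOQ.Det y y.ele S →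
        HOQ.Det (.arrow (.elem (HOQ.compIn x y)) (.elem (HOQ.compOut x y))) _
          (HOQ.link R S) :=
  HOQ.admissibleComp_iff hx hy
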